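/- **Setting.** Let $n,m\ge 1$. A *system of robots* consists of finitely many pairwise disjoint unit circles $C_i$ in the plane (the trajectories), one robot starting on each, and a communication range $r\ge 0$. Its *communication graph* has the circles as vertices, two being adjacent iff their centers are at distance at most $2+r$. For adjacent $C_i,C_j$ the *link position* $\phi_{ij}$ is the angle of the point of $C_i$ closest to $C_j$. A *schedule* $(f,g)$ assigns to each circle a starting angle $f(C_i)$ and a direction $g(C_i)\in\{1,-1\}$; the scheduled position on $C_i$ at time $t\ge 0$ is the angle $f(C_i)+2\pi g(C_i)t$ modulo $2\pi$. The schedule defines a *synchronized communication system* (SCS) if, for all adjacent $C_i,C_j$, $g(C_i)=-g(C_j)$ and at every time $t\ge0$ the scheduled position on $C_i$ is $\phi_{ij}$ iff the one on $C_j$ is $\phi_{ji}$. In an SCS some robots may fail (leave forever), possibly at different times. The remaining robots follow the scheduled positions; whenever a robot on $C_i$ arrives at $\phi_{ij}$ and there is no robot on $C_j$, it passes instantly to $C_j$ and follows the schedule of $C_j$; otherwise it stays on its circle. A circle is *covered* if each of its points is visited periodically by the surviving (never failing) robots. The *uncovering-resilience* of the SCS is the largest $k$ such that, whichever robots fail,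 at most $k$ in number, and whenever they fail, all circles are covered. The system has an *$n\times m$ grid communication graph* if its circles are indexed by $(i,j)$, $1\le i\le n$, $1\le j\le m$, the centers of each row being aligned horizontally and those of each column vertically (rows numbered from top to bottom, columns from left to right), and $(i,j)$ is adjacent in the communication graph exactly to those of $(i\pm1,j)$, $(i,j\pm1)$ that exist. **Theorem.** For every system of robots with an $n\times m$ grid communication graph there is a schedule that defines an SCS, and for every such schedule the uncovering-resilience of the SCS is $$\frac{n\cdot m}{\gcd(n,m)}-1 .$$ -/

import Mathlib

open scoped Topology

/-- A system of robots: pairwise disjoint unit circles (the trajectories, indexed by `V` and given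
by their centers in the plane `ℂ`) and a communication range. There is one robot per trajectory;
robots are identified with the index of the trajectory on which they start. -/
structure RobotSystem (V : Type*) where
  center : V → ℂ
  range : ℝ
  range_nonneg : 0 ≤ range
  disjoint_circles : Pairwise fun i j =>
    Disjoint (Metric.sphere (center i) 1) (Metric.sphere (center j) 1)

namespace RobotSystem

variable {V : Type*} (S : RobotSystem V)

/-- The trajectory with index `i`. -/
def circle (i : V) : Set ℂ := Metric.sphere (S.center i) 1

/-- The point at angle `θ` (measured from the positive horizontal axis) of trajectory `i`. -/
noncomputable def point (i : V) (θ : Real.Angle) : ℂ := S.center i + (θ.toCircle : ℂ)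

/-- The communication graph: trajectories are adjacent iff their centers are at distance at most
`2 + r`, where `r` is the communication range. -/
def commGraph : SimpleGraph V where
  Adj i j := i ≠ j ∧ dist (S.center i) (S.center j) ≤ 2 + S.range
  symm := ⟨fun _ _ h => ⟨h.1.symm, by rw [dist_comm]; exact h.2⟩⟩
  loopless := ⟨fun _ h => h.1 rfl⟩

/-- The link position of trajectory `i` with respect to trajectory `j`: the angle of the point of
circle `i` that is closest to circle `j`, that is, the direction from the center of `i` to the
center of `j` (see `infDist_linkPosition_le`). -/
noncomputable def linkPosition (i j : V) : Real.Angle :=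
  ((S.center j - S.center i).arg : Real.Angle)

end RobotSystem

/-- A schedule: a starting angle and a direction of movement (`1` is counterclockwise, `-1` is
clockwise) for every trajectory. -/
structure Schedule (V : Type*) where
  start : V → Real.Angle
  dir : V → ℤˣ

/-- The scheduled position on trajectory `i` at time `t` (one tour takes one unit of time). -/
noncomputable def Schedule.position {V : Type*} (F : Schedule V) (i : V) (t : ℝ) : Real.Angle :=
  F.start i + ((((F.dir i : ℤ) : ℝ) * (2 * Real.pi * t) : ℝ) : Real.Angle)

/-- `F` makes `S` a synchronized communication system: neighbors move in opposite directions, and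
they always arrive simultaneously at their link positions. -/
structure IsSCS {V : Type*} (S : RobotSystem V) (F : Schedule V) : Prop where
  opposite : ∀ i j, S.commGraph.Adj i j → F.dir i = -F.dir j
  synchronized : ∀ i j, S.commGraph.Adj i j → ∀ t : ℝ, 0 ≤ t →
    (F.position i t = S.linkPosition i j ↔ F.position j t = S.linkPosition j i)

/-- Which robots leave the team, and when (possibly at different times). The values of `time`
at robots that do not leave are irrelevant. -/
structure Failures (V : Type*) where
  failed : Finset V
  time : V → ℝ
  time_nonneg : ∀ u, 0 ≤ time u

/-- Robot `u` is still in the team at time `t`. -/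
def Failures.Alive {V : Type*} (P : Failures V) (u : V) (t : ℝ) : Prop :=
  u ∈ P.failed → t < P.time u

/-- Given that robot `v` is on trajectory `loc v t` at time `t`, trajectory `j` carries no robot at
time `t`. -/
def Vacant {V : Type*} (P : Failures V) (loc : V → ℝ → V) (j : V) (t : ℝ) : Prop :=
  ∀ v, P.Alive v t → loc v t ≠ j

/-- At time `t`, robot `u` arrives at the link position of its trajectory with respect to
trajectory `j`, and `j` is empty. -/
def MustPass {V : Type*} (S : RobotSystem V) (F : Schedule V) (P : Failures V) (loc : V → ℝ → V)
    (u : V) (t : ℝ) (j : V) : Prop :=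
  S.commGraph.Adj (loc u t) j ∧ F.position (loc u t) t = S.linkPosition (loc u t) j ∧
    Vacant P loc j t

/-- `loc u t` is the trajectory that robot `u` follows at time `t` in the partial SCS obtained from
the failures `P`; on it, the robot is at the scheduled position. A robot that arrives at time `t`
at a link position with an empty neighboring trajectory passes to it instantly (at time `t` itself
it is counted on the trajectory on which it arrived); otherwise it stays on its trajectory. Nothing
is required of a robot once it has left. -/
structure IsPartialSCS {V : Type*} (S : RobotSystem V) (F : Schedule V) (P : Failures V)
    (loc : V → ℝ → V) : Prop where
  init : ∀ u, loc u 0 = u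
  arrive : ∀ u t, 0 < t → P.Alive u t → ∀ᶠ s in 𝓝[<] t, loc u s = loc u t
  pass : ∀ u t, 0 ≤ t → P.Alive u t → ∀ j, MustPass S F P loc u t j →
    ∀ᶠ s in 𝓝[>] t, loc u s = j
  stay : ∀ u t, 0 ≤ t → P.Alive u t → (∀ j, ¬ MustPass S F P loc u t j) →
    ∀ᶠ s in 𝓝[>] t, loc u s = loc u t

/-- Trajectory `i` is covered: each of its points is visited periodically by the surviving
robots. -/
def Covered {V : Type*} (F : Schedule V) (P : Failures V) (loc : V → ℝ → V) (i : V) : Prop :=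
  ∀ θ : Real.Angle, ∃ t₀ p : ℝ, 0 ≤ t₀ ∧ 0 < p ∧ ∀ k : ℕ, ∃ u, u ∉ P.failed ∧
    loc u (t₀ + k * p) = i ∧ F.position i (t₀ + k * p) = θ

/-- Whichever robots fail, at most `k` in number, and whenever they fail, all trajectories are
covered by the surviving robots. -/
def ToleratesFailures {V : Type*} (S : RobotSystem V) (F : Schedule V) (k : ℕ) : Prop :=
  ∀ (P : Failures V) (loc : V → ℝ → V), P.failed.card ≤ k → IsPartialSCS S F P loc →
    ∀ i, Covered F P loc i

/-- `k` is the uncovering-resilience of the SCS on `S` with schedule `F`: the maximum number of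
robots that can fail such that all trajectories are covered by the surviving robots. -/
def IsUncoveringResilience {V : Type*} (S : RobotSystem V) (F : Schedule V) (k : ℕ) : Prop :=
  IsGreatest {k | ToleratesFailures S F k} k

/-- The communication graph has an `n × m` grid configuration: the trajectories lie in `n` rows,
numbered from top to bottom, and `m` columns, numbered from left to right, and `(i, j)` is linked
exactly to those of `(i ± 1, j)`, `(i, j ± 1)` that exist. -/
structure IsGrid {n m : ℕ} (S : RobotSystem (Fin n × Fin m)) : Prop where
  aligned : ∃ (x : Fin m → ℝ) (y : Fin n → ℝ), StrictMono x ∧ StrictAnti y ∧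
    ∀ i j, S.center (i, j) = ⟨x j, y i⟩
  graph_eq : S.commGraph = SimpleGraph.pathGraph n □ SimpleGraph.pathGraph m

/-- Disjoint unit circles have centers more than `2` apart. -/
theorem RobotSystem.two_lt_dist {V : Type*} (S : RobotSystem V) {i j : V} (h : i ≠ j) :
    2 < dist (S.center i) (S.center j) := by
  by_contra hle
  push Not at hle
  set w : ℂ := S.center j - S.center i with hw
  have hd : dist (S.center i) (S.center j) = ‖w‖ := by rw [dist_comm, dist_eq_norm]
  rw [hd] at hle
  have key : ∃ z : ℂ, ‖z‖ = 1 ∧ ‖z - w‖ = 1 := by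
    by_cases h0 : w = 0
    · exact ⟨1, by simp, by simp [h0]⟩
    · have hpos : 0 < ‖w‖ := norm_pos_iff.mpr h0
      set s : ℝ := Real.sqrt (1 / ‖w‖ ^ 2 - 1 / 4) with hs
      have hnn : 0 ≤ 1 / ‖w‖ ^ 2 - 1 / 4 := by
        have : 1 / 4 ≤ 1 / ‖w‖ ^ 2 := one_div_le_one_div_of_le (by positivity) (by nlinarith)
        linarith
      have hsq : s ^ 2 = 1 / ‖w‖ ^ 2 - 1 / 4 := Real.sq_sqrt hnn
      have hn : ∀ a : ℝ, a ^ 2 = 1 / 4 → ‖w * (⟨a, s⟩ : ℂ)‖ = 1 := by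
        intro a ha
        rw [norm_mul]
        have h1 : ‖(⟨a, s⟩ : ℂ)‖ ^ 2 = 1 / ‖w‖ ^ 2 := by
          rw [Complex.sq_norm, Complex.normSq_mk]; nlinarith
        have h2 : (‖w‖ * ‖(⟨a, s⟩ : ℂ)‖) ^ 2 = 1 := by
          rw [mul_pow, h1]; field_simp
        have h3 : 0 ≤ ‖w‖ * ‖(⟨a, s⟩ : ℂ)‖ := by positivity
        nlinarith
      refine ⟨w * ⟨1 / 2, s⟩, hn _ (by norm_num), ?_⟩
      have : w * (⟨1 / 2, s⟩ : ℂ) - w = w * ⟨-(1 / 2), s⟩ := by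
        have : (⟨1 / 2, s⟩ : ℂ) - 1 = ⟨-(1 / 2), s⟩ := by
          apply Complex.ext <;> simp; norm_num
        rw [← this]; ring
      rw [this]
      exact hn _ (by norm_num)
  obtain ⟨z, hz1, hz2⟩ := key
  refine (Set.disjoint_left.mp (S.disjoint_circles h) : ∀ ⦃a⦄, a ∈ _ → a ∉ _)
    (a := S.center i + z) ?_ ?_
  · simpa using hz1
  · rw [mem_sphere_iff_norm, ← hz2, hw]; congr 1; ring

/-- Among all points of circle `i`, the one at the link position is closest to circle `j`. -/
theorem RobotSystem.infDist_linkPosition_le {V : Type*} (S : RobotSystem V) {i j : V} (h : i ≠ j)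
    {q : ℂ} (hq : q ∈ S.circle i) :
    Metric.infDist (S.point i (S.linkPosition i j)) (S.circle j) ≤
      Metric.infDist q (S.circle j) := by
  have hD := S.two_lt_dist h
  rw [dist_comm, dist_eq_norm] at hD
  set w : ℂ := S.center j - S.center i with hw
  set e : ℂ := ((S.linkPosition i j).toCircle : ℂ) with he
  have he1 : ‖e‖ = 1 := Circle.norm_coe _
  have hwe : w = ‖w‖ * e := by
    rw [he, linkPosition, Real.Angle.toCircle_coe, Circle.coe_exp, ← hw]
    exact (Complex.norm_mul_exp_arg_mul_I w).symm
  have hmem : S.center j - e ∈ S.circle j := by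
    simp [circle, he1]
  refine (Metric.infDist_le_dist_of_mem hmem).trans ?_
  have h1 : dist (S.point i (S.linkPosition i j)) (S.center j - e) = ‖w‖ - 2 := by
    have h2 : S.point i (S.linkPosition i j) - (S.center j - e) = ((2 - ‖w‖ : ℝ) : ℂ) * e := by
      have h3 : S.center j = S.center i + ‖w‖ * e := by rw [← hwe, hw]; ring
      rw [point, ← he, h3]; push_cast; ring
    rw [dist_eq_norm, h2, norm_mul, he1, mul_one, Complex.norm_real, Real.norm_eq_abs,
      abs_of_neg (by linarith)]
    ring
  rw [h1]
  refine (Metric.le_infDist ⟨_, hmem⟩).mpr fun p hp => ?_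
  have h4 : dist (S.center j) (S.center i) ≤
      dist (S.center j) p + dist p q + dist q (S.center i) := dist_triangle4 _ _ _ _
  rw [dist_eq_norm, ← hw] at h4
  have h5 : dist p (S.center j) = 1 := hp
  have h6 : dist q (S.center i) = 1 := hq
  rw [dist_comm] at h5
  rw [dist_comm q p]
  linarith

/-!
The proof follows tokens instead of robots. Imagine a token on every trajectory that moves with the
scheduled position and changes trajectories at every link position. When a robot meets an empty
trajectory, it goes along with its token; when two robots meet, both stay, which amounts to
exchanging their tokens. Hence different surviving robots are always on different tokens
(`LinkClock.loc_injective`), and a token that carries a robot has carried one at all earlier times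
(`LinkClock.exists_alive_on_token`). Once all failures have happened, the set of tokens that carry
robots is constant, and it has as many elements as there are survivors
(`LinkClock.exists_surviving_tokens`).

In one unit of time the tokens undergo a permutation `Q` of the trajectories, and its cycles are the
rings of the system. Suppose that all rings have length `L`. After at most `L - 1` failures every
ring keeps a token with a surviving robot, and this token visits each point of the ring once in `L`
units of time (`LinkClock.toleratesFailures`). If on the other hand the `L` robots of a ring fail at
time `0`, then the ring stays empty (`LinkClock.not_toleratesFailures`); here a motion of the
remaining robots has to be constructed (`LinkClock.isPartialSCS_discreteLoc`).

On a grid, a synchronized schedule is determined by its values in the upper left corner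
(`IsGrid.position_eq`). It follows that all robots reach multiples of a quarter turn simultaneously,
and that these events concern alternately all rows and all columns (`IsGrid.exists_linkClock`). The
events within rows swap neighboring columns, alternately the pairs `{0, 1}, {2, 3}, …` and the pairs
`{1, 2}, {3, 4}, …`. The composition of these two swaps is an `m`-cycle
(`pathSwap_comp_iterate_eq_iff`). The same holds for the rows, so that `Q` is the product of an
`n`-cycle and an `m`-cycle, and all its cycles have length `lcm n m = n * m / gcd n m`
(`tokenMap_gridStep_iterate_eq_iff`).
-/

/-! ### Events and tokens -/

/-- The events of a schedule. Robots can only change trajectories at the times `τ + k / 4`, and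
at the `k`-th of these the trajectories `v` and `M k v` have their link positions facing each other
(`M k v = v` if no neighbor of `v` is met). The offset `τ` is the first event time that is not
negative. -/
structure LinkClock {V : Type*} (S : RobotSystem V) (F : Schedule V) (τ : ℝ) (M : ℕ → V → V) :
    Prop where
  nonneg : 0 ≤ τ
  lt_quarter : τ < 1 / 4
  involutive : ∀ k, Function.Involutive (M k)
  periodic : ∀ k, M (k + 4) = M k
  link_iff : ∀ v w t, 0 ≤ t → (S.commGraph.Adj v w ∧ F.position v t = S.linkPosition v w ↔
    ∃ k : ℕ, t = τ + k / 4 ∧ M k v = w ∧ v ≠ w)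

/-- The number of events strictly before time `t`, for events at the times `τ + k / 4`. -/
noncomputable def eventCount (τ t : ℝ) : ℕ := ⌈4 * (t - τ)⌉₊

theorem eventCount_mono (τ : ℝ) : Monotone (eventCount τ) := fun _ _ h =>
  Nat.ceil_mono (by linarith)

theorem eventCount_event (τ : ℝ) (k : ℕ) : eventCount τ (τ + k / 4) = k := by
  rw [eventCount, show 4 * (τ + (k : ℝ) / 4 - τ) = k by ring, Nat.ceil_natCast]

theorem eventCount_eq_succ_iff (τ t : ℝ) (k : ℕ) :
    eventCount τ t = k + 1 ↔ τ + k / 4 < t ∧ t ≤ τ + (k + 1) / 4 := by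
  rw [eventCount, Nat.ceil_eq_iff (Nat.succ_ne_zero k)]
  push_cast [Nat.add_sub_cancel]
  constructor <;> rintro ⟨h1, h2⟩ <;> constructor <;> linarith

theorem eventCount_zero_of_nonneg {τ : ℝ} (h : 0 ≤ τ) : eventCount τ 0 = 0 := by
  rw [eventCount, Nat.ceil_eq_zero]; linarith

theorem eventCount_add_nat {τ t : ℝ} (hτ : τ < 1 / 4) (ht : 0 ≤ t) (k : ℕ) :
    eventCount τ (t + k) = eventCount τ t + 4 * k := by
  have h1 : 4 * (t + k - τ) = 4 * (t - τ) + ((4 * k : ℕ) : ℝ) := by push_cast; ring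
  have h2 : -1 < 4 * (t - τ) := by linarith
  have h3 : 0 ≤ ⌈4 * (t - τ)⌉ := by
    have : -1 < ⌈4 * (t - τ)⌉ := Int.lt_ceil.mpr (by simpa using h2)
    omega
  zify
  rw [eventCount, eventCount, Int.natCast_ceil_eq_ceil_of_neg_one_lt h2, h1,
    Int.natCast_ceil_eq_ceil_of_neg_one_lt (by have : (0 : ℝ) ≤ ((4 * k : ℕ) : ℝ) := by positivity
                                               linarith), Int.ceil_add_natCast]
  push_cast; ring

/-- No event takes place in `[s, t)` if `s` and `t` have the same number of events before them. -/
theorem event_notMem_Ico {τ s t : ℝ} (h : eventCount τ s = eventCount τ t) (k : ℕ) :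
    τ + k / 4 ∉ Set.Ico s t := by
  rintro ⟨h1, h2⟩
  have h3 := eventCount_mono τ h1
  rw [eventCount_event] at h3
  have h4 : k < eventCount τ t := Nat.lt_ceil.mpr (by linarith)
  omega

theorem eventually_eventCount_nhdsLT (τ t : ℝ) :
    ∀ᶠ s in 𝓝[<] t, eventCount τ s = eventCount τ t := by
  rcases h : eventCount τ t with _ | k
  · filter_upwards [self_mem_nhdsWithin] with s hs
    have := eventCount_mono τ (le_of_lt (Set.mem_Iio.mp hs))
    omega
  · have ht := (eventCount_eq_succ_iff τ t k).mp h
    filter_upwards [Ioo_mem_nhdsLT ht.1] with s hs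
    exact (eventCount_eq_succ_iff τ s k).mpr ⟨hs.1, hs.2.le.trans ht.2⟩

theorem eventually_eventCount_nhdsGT_event (τ : ℝ) (k : ℕ) :
    ∀ᶠ s in 𝓝[>] (τ + k / 4), eventCount τ s = k + 1 := by
  have : τ + (k : ℝ) / 4 < τ + (k + 1) / 4 := by linarith
  filter_upwards [Ioo_mem_nhdsGT this] with s hs
  exact (eventCount_eq_succ_iff τ s k).mpr ⟨hs.1, hs.2.le⟩

theorem eventually_eventCount_nhdsGT {τ t : ℝ} (h : ∀ k : ℕ, t ≠ τ + k / 4) :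
    ∀ᶠ s in 𝓝[>] t, eventCount τ s = eventCount τ t := by
  rcases h' : eventCount τ t with _ | k
  · have h1 : 4 * (t - τ) ≤ 0 := Nat.ceil_eq_zero.mp h'
    have h2 : t ≠ τ := by simpa using h 0
    have h3 : t < τ := lt_of_le_of_ne (by linarith) h2
    filter_upwards [Ioo_mem_nhdsGT h3] with s hs
    exact Nat.ceil_eq_zero.mpr (by linarith [hs.2])
  · have ht := (eventCount_eq_succ_iff τ t k).mp h'
    have h3 : t < τ + (k + 1) / 4 := lt_of_le_of_ne ht.2 (by simpa using h (k + 1))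
    filter_upwards [Ioo_mem_nhdsGT h3] with s hs
    exact (eventCount_eq_succ_iff τ s k).mpr ⟨ht.1.trans hs.1, hs.2.le⟩

/-- The trajectory that carries, after `k` events, the token that started on `v`. Tokens follow the
scheduled positions and change trajectories at every link position. -/
def tokenMap {V : Type*} (M : ℕ → V → V) : ℕ → V → V
  | 0 => id
  | k + 1 => M k ∘ tokenMap M k

theorem tokenMap_bijective {V : Type*} {M : ℕ → V → V} (hM : ∀ k, Function.Involutive (M k))
    (k : ℕ) : Function.Bijective (tokenMap M k) := by
  induction k with
  | zero => exact Function.bijective_id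
  | succ k ih => exact (hM k).bijective.comp ih

theorem tokenMap_add_four_mul {V : Type*} {M : ℕ → V → V} (hM : ∀ k, M (k + 4) = M k) (r k : ℕ)
    (x : V) : tokenMap M (r + 4 * k) x = tokenMap M r ((tokenMap M 4)^[k] x) := by
  have h4 : ∀ r, tokenMap M (r + 4) = tokenMap M r ∘ tokenMap M 4 := by
    intro r
    induction r with
    | zero => rfl
    | succ r ih =>
      rw [show r + 1 + 4 = (r + 4) + 1 by ring]
      simp only [tokenMap] at ih ⊢
      rw [hM, ih]; rfl
  induction k generalizing x with
  | zero => rfl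
  | succ k ih =>
    rw [show r + 4 * (k + 1) = r + 4 * k + 4 by ring, h4, Function.comp_apply, ih,
      Function.iterate_succ_apply]

/-! ### The motion of robots in a partial SCS -/

theorem Failures.Alive.mono {V : Type*} {P : Failures V} {u : V} {s t : ℝ} (h : P.Alive u t)
    (hst : s ≤ t) : P.Alive u s := fun hu => hst.trans_lt (h hu)

theorem Failures.alive_of_notMem {V : Type*} {P : Failures V} {u : V} (h : u ∉ P.failed) (t : ℝ) :
    P.Alive u t := fun hu => absurd hu h

theorem eq_of_eventually_eq_on_Icc {V : Type*} {f : ℝ → V} {s t : ℝ} (hst : s ≤ t)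
    (hl : ∀ x ∈ Set.Ioc s t, ∀ᶠ y in 𝓝[<] x, f y = f x)
    (hr : ∀ x ∈ Set.Ico s t, ∀ᶠ y in 𝓝[>] x, f y = f x) : f s = f t := by
  let _ : TopologicalSpace V := ⊥
  have _ : DiscreteTopology V := ⟨rfl⟩
  have hc : ContinuousOn f (Set.Icc s t) := by
    intro x hx
    have key : ∀ᶠ y in 𝓝[Set.Icc s t] x, f y = f x := by
      have hL : ∀ᶠ y in 𝓝[Set.Icc s t ∩ Set.Iio x] x, f y = f x := by
        rcases eq_or_lt_of_le hx.1 with h | h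
        · have : Set.Icc s t ∩ Set.Iio x = ∅ := by
            ext y; simp; intro a _; linarith
          simp [this]
        · exact (hl x ⟨h, hx.2⟩).filter_mono (nhdsWithin_mono _ Set.inter_subset_right)
      have hR : ∀ᶠ y in 𝓝[Set.Icc s t ∩ Set.Ioi x] x, f y = f x := by
        rcases eq_or_lt_of_le hx.2 with h | h
        · have : Set.Icc s t ∩ Set.Ioi x = ∅ := by
            ext y; simp; intro _ a; linarith
          simp [this]
        · exact (hr x ⟨hx.1, h⟩).filter_mono (nhdsWithin_mono _ Set.inter_subset_right)
      rw [eventually_nhdsWithin_iff] at hL hR ⊢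
      filter_upwards [hL, hR] with y h1 h2 hy
      rcases lt_trichotomy y x with h | h | h
      · exact h1 ⟨hy, h⟩
      · rw [h]
      · exact h2 ⟨hy, h⟩
    rw [ContinuousWithinAt, nhds_discrete V, Filter.tendsto_pure]
    exact key
  exact isPreconnected_Icc.constant hc (Set.left_mem_Icc.mpr hst) (Set.right_mem_Icc.mpr hst)

namespace LinkClock

variable {V : Type*} {S : RobotSystem V} {F : Schedule V} {τ : ℝ} {M : ℕ → V → V}
  {P : Failures V} {loc : V → ℝ → V}

theorem mustPass_iff (hC : LinkClock S F τ M) {u j : V} {t : ℝ} (ht : 0 ≤ t) :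
    MustPass S F P loc u t j ↔
      (∃ k : ℕ, t = τ + k / 4 ∧ M k (loc u t) = j ∧ loc u t ≠ j) ∧ Vacant P loc j t := by
  rw [MustPass, ← and_assoc, hC.link_iff _ _ _ ht]

theorem event_nonneg (hC : LinkClock S F τ M) (k : ℕ) : 0 ≤ τ + k / 4 := by
  have := hC.nonneg; positivity

theorem loc_eq_of_eventCount_eq (hC : LinkClock S F τ M) (hP : IsPartialSCS S F P loc) {u : V}
    {s t : ℝ} (hs : 0 ≤ s) (hst : s ≤ t) (hu : P.Alive u t)
    (h : eventCount τ s = eventCount τ t) : loc u s = loc u t := by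
  refine eq_of_eventually_eq_on_Icc hst (fun x hx => ?_) (fun x hx => ?_)
  · exact hP.arrive u x (hs.trans_lt hx.1) (hu.mono hx.2)
  · refine hP.stay u x (hs.trans hx.1) (hu.mono hx.2.le) fun j hj => ?_
    rw [hC.mustPass_iff (hs.trans hx.1)] at hj
    obtain ⟨⟨k, hk, -⟩, -⟩ := hj
    exact event_notMem_Ico h k (hk ▸ hx)

/-- What happens to a robot that survives an event: it goes to the facing trajectory if that is
empty, and stays otherwise. -/
theorem loc_after_event (hC : LinkClock S F τ M) (hP : IsPartialSCS S F P loc) {u : V} {t : ℝ}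
    {k : ℕ} (hu : P.Alive u t) (h : eventCount τ t = k + 1) :
    (loc u t = M k (loc u (τ + k / 4)) ∧ Vacant P loc (loc u t) (τ + k / 4)) ∨
      (loc u t = loc u (τ + k / 4) ∧ ¬ Vacant P loc (M k (loc u t)) (τ + k / 4)) := by
  have ht := (eventCount_eq_succ_iff τ t k).mp h
  have h0 := hC.event_nonneg k
  set T : ℝ := τ + k / 4 with hT
  have hloc : ∀ w, (∀ᶠ s in 𝓝[>] T, loc u s = w) → loc u t = w := by
    intro w hw
    obtain ⟨s, hs, hs'⟩ := (hw.and (Ioo_mem_nhdsGT ht.1)).exists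
    rw [← hs]
    refine (hC.loc_eq_of_eventCount_eq hP (h0.trans hs'.1.le) hs'.2.le hu ?_).symm
    rw [h]
    exact (eventCount_eq_succ_iff τ s k).mpr ⟨hs'.1, hs'.2.le.trans ht.2⟩
  have hk : ∀ l : ℕ, T = τ + l / 4 → l = k := by
    intro l hl
    have : (l : ℝ) = k := by linarith
    exact_mod_cast this
  have huT := hu.mono ht.1.le
  by_cases hv : Vacant P loc (M k (loc u T)) T
  · left
    have hne : loc u T ≠ M k (loc u T) := hv u huT
    have := hloc _ (hP.pass u T h0 huT (M k (loc u T))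
      ((hC.mustPass_iff h0).mpr ⟨⟨k, hT, rfl, hne⟩, hv⟩))
    exact ⟨this, this ▸ hv⟩
  · right
    have := hloc _ (hP.stay u T h0 huT fun j hj => by
      obtain ⟨⟨l, hl, rfl, -⟩, hj⟩ := (hC.mustPass_iff h0).mp hj
      rw [hk l hl] at hj
      exact hv hj)
    exact ⟨this, this ▸ hv⟩

/-- Two robots are never on the same trajectory. -/
theorem loc_injective (hC : LinkClock S F τ M) (hP : IsPartialSCS S F P loc) {u v : V} {t : ℝ}
    (ht : 0 ≤ t) (hu : P.Alive u t) (hv : P.Alive v t) (huv : loc u t = loc v t) : u = v := by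
  obtain ⟨k, hk⟩ : ∃ k, eventCount τ t = k := ⟨_, rfl⟩
  induction k generalizing u v t with
  | zero =>
    have h0 : eventCount τ 0 = eventCount τ t := by rw [hk, eventCount_zero_of_nonneg hC.nonneg]
    rw [← hC.loc_eq_of_eventCount_eq hP le_rfl ht hu h0,
      ← hC.loc_eq_of_eventCount_eq hP le_rfl ht hv h0, hP.init, hP.init] at huv
    exact huv
  | succ k ih =>
    have hT := ((eventCount_eq_succ_iff τ t k).mp hk).1.le
    have huT := hu.mono hT
    have hvT := hv.mono hT
    refine ih (hC.event_nonneg k) huT hvT ?_ (eventCount_event τ k)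
    rcases hC.loc_after_event hP hu hk with ⟨h1, h2⟩ | ⟨h1, h2⟩ <;>
      rcases hC.loc_after_event hP hv hk with ⟨h3, h4⟩ | ⟨h3, h4⟩
    · rw [h1, h3] at huv
      exact (hC.involutive k).injective huv
    · exact absurd (by rw [← h3, huv]) (h2 v hvT)
    · exact absurd (by rw [← h1, huv]) (h4 u huT)
    · rw [← h1, ← h3, huv]

/-- A token that carries a robot at time `t` carried a robot at all earlier times: if the facing
trajectory is occupied at a link position, the two robots exchange their tokens. -/
theorem exists_alive_on_token (hC : LinkClock S F τ M) (hP : IsPartialSCS S F P loc) {u x : V}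
    {s t : ℝ} (hs : 0 ≤ s) (hst : s ≤ t) (hu : P.Alive u t)
    (hx : loc u t = tokenMap M (eventCount τ t) x) :
    ∃ v, P.Alive v s ∧ loc v s = tokenMap M (eventCount τ s) x := by
  obtain ⟨k, hk⟩ : ∃ k, eventCount τ t = k := ⟨_, rfl⟩
  induction k generalizing u t with
  | zero =>
    have h0 : eventCount τ s = eventCount τ t :=
      le_antisymm (eventCount_mono τ hst) (by omega)
    exact ⟨u, hu.mono hst, by rw [hC.loc_eq_of_eventCount_eq hP hs hst hu h0, hx, h0]⟩
  | succ k ih =>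
    by_cases h0 : eventCount τ s = eventCount τ t
    · exact ⟨u, hu.mono hst, by rw [hC.loc_eq_of_eventCount_eq hP hs hst hu h0, hx, h0]⟩
    have hT := (eventCount_eq_succ_iff τ t k).mp hk
    have hsT : s ≤ τ + k / 4 := by
      by_contra hlt
      push Not at hlt
      exact h0 (by rw [hk, (eventCount_eq_succ_iff τ s k).mpr ⟨hlt, hst.trans hT.2⟩])
    rw [hk] at hx
    have hx' : M k (loc u t) = tokenMap M k x := by
      rw [hx]; exact hC.involutive k _
    rcases hC.loc_after_event hP hu hk with ⟨h1, h2⟩ | ⟨h1, h2⟩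
    · refine ih hsT (hu.mono hT.1.le) ?_ (eventCount_event τ k)
      rw [eventCount_event, ← hx', h1, hC.involutive k]
    · simp only [Vacant, not_forall, not_not] at h2
      obtain ⟨v, hv, hv'⟩ := h2
      refine ih hsT hv ?_ (eventCount_event τ k)
      rw [eventCount_event, hv', hx']

end LinkClock

/-! ### Scheduled positions -/

theorem Schedule.position_add_nat {V : Type*} (F : Schedule V) (i : V) (t : ℝ) (k : ℕ) :
    F.position i (t + k) = F.position i t := by
  rw [Schedule.position, Schedule.position]
  congr 1
  rw [Real.Angle.angle_eq_iff_two_pi_dvd_sub]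
  exact ⟨(F.dir i : ℤ) * k, by push_cast; ring⟩

theorem Schedule.exists_position_eq {V : Type*} (F : Schedule V) (i : V) (θ : Real.Angle) :
    ∃ t : ℝ, 0 ≤ t ∧ F.position i t = θ := by
  have hd : ((F.dir i : ℤ) : ℝ) * ((F.dir i : ℤ) : ℝ) = 1 := by
    exact_mod_cast Int.units_coe_mul_self (F.dir i)
  set d : ℝ := ((F.dir i : ℤ) : ℝ) with hd'
  set y : ℝ := d * (θ - F.start i).toReal / (2 * Real.pi)
  obtain ⟨N, hN⟩ := exists_nat_ge (-y)
  refine ⟨y + N, by linarith, ?_⟩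
  rw [F.position_add_nat, Schedule.position, ← hd']
  have : d * (2 * Real.pi * y) = (θ - F.start i).toReal := by
    have : d * (2 * Real.pi * y) = d * d * (θ - F.start i).toReal := by
      simp only [y]; field_simp
    rw [this, hd, one_mul]
  rw [this, Real.Angle.coe_toReal]; abel

theorem Schedule.position_eq_iff {V : Type*} (F : Schedule V) (i : V) (s t : ℝ) :
    F.position i s = F.position i t ↔ ∃ z : ℤ, s = t + z := by
  rw [Schedule.position, Schedule.position, add_right_inj, Real.Angle.angle_eq_iff_two_pi_dvd_sub]
  have hd : ((F.dir i : ℤ) : ℝ) * ((F.dir i : ℤ) : ℝ) = 1 := by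
    exact_mod_cast Int.units_coe_mul_self (F.dir i)
  constructor
  · rintro ⟨z, hz⟩
    refine ⟨(F.dir i : ℤ) * z, ?_⟩
    have h1 : 2 * Real.pi * ((((F.dir i : ℤ) : ℝ) * ((F.dir i : ℤ) : ℝ)) * (s - t))
      = 2 * Real.pi * (((F.dir i : ℤ) : ℝ) * z) := by
      linear_combination ((F.dir i : ℤ) : ℝ) * hz
    have h2 := mul_left_cancel₀ Real.two_pi_pos.ne' h1
    rw [hd] at h2
    push_cast
    linarith
  · rintro ⟨z, rfl⟩
    exact ⟨(F.dir i : ℤ) * z, by push_cast; ring⟩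

/-! ### Surviving tokens on a ring -/

/-- If all cycles of a permutation `Q` have length `L`, then the cycle of `x` has `L` elements. -/
theorem card_filter_iterate {V : Type*} [Fintype V] {Q : V → V} {L : ℕ} (hL : 0 < L)
    (hQ : ∀ k x, Q^[k] x = x ↔ L ∣ k) (x : V) [DecidablePred fun y => ∃ a, Q^[a] x = y] :
    (Finset.univ.filter fun y => ∃ a, Q^[a] x = y).card = L := by
  classical
  have hmod : ∀ a, Q^[a] x = Q^[a % L] x := by
    intro a
    conv_lhs => rw [← Nat.mod_add_div a L, Function.iterate_add_apply]
    rw [(hQ (L * (a / L)) x).mpr (dvd_mul_right _ _)]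
  have hbij : Function.Injective Q := by
    have h : Function.Injective Q^[L] := fun a b hab => by
      rwa [(hQ L a).mpr dvd_rfl, (hQ L b).mpr dvd_rfl] at hab
    exact Function.Injective.of_comp (f := Q^[L - 1])
      (by rw [← Function.iterate_succ, Nat.succ_eq_add_one, Nat.sub_add_cancel hL]; exact h)
  have himg : (Finset.univ.filter fun y => ∃ a, Q^[a] x = y) =
      (Finset.range L).image fun a => Q^[a] x := by
    ext y
    simp only [Finset.mem_filter, Finset.mem_univ, true_and, Finset.mem_image, Finset.mem_range]
    constructor
    · rintro ⟨a, rfl⟩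
      exact ⟨a % L, Nat.mod_lt _ hL, (hmod a).symm⟩
    · rintro ⟨a, -, rfl⟩
      exact ⟨a, rfl⟩
  have hle : ∀ a b, a ≤ b → b < L → Q^[a] x = Q^[b] x → a = b := by
    intro a b hab hb h
    obtain ⟨c, rfl⟩ := Nat.exists_eq_add_of_le hab
    rw [Function.iterate_add_apply] at h
    have h1 := (hQ c x).mp (hbij.iterate a h).symm
    have := Nat.eq_zero_of_dvd_of_lt h1 (by omega)
    omega
  rw [himg, Finset.card_image_of_injOn, Finset.card_range]
  intro a ha b hb h
  rcases le_total a b with hab | hab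
  · exact hle a b hab (by simpa using hb) h
  · exact (hle b a hab (by simpa using ha) h.symm).symm

namespace LinkClock

variable {V : Type*} {S : RobotSystem V} {F : Schedule V} {τ : ℝ} {M : ℕ → V → V}
  {P : Failures V} {loc : V → ℝ → V}

/-- Some tokens carry surviving robots forever, and there are as many of them as survivors. -/
theorem exists_surviving_tokens [Fintype V] (hC : LinkClock S F τ M)
    (hP : IsPartialSCS S F P loc) :
    ∃ (T : ℝ) (O : Finset V), Fintype.card V ≤ P.failed.card + O.card ∧
      ∀ t, 0 ≤ t → T ≤ t → ∀ x ∈ O, ∃ u ∉ P.failed, loc u t = tokenMap M (eventCount τ t) x := by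
  classical
  obtain ⟨T, hT0, hT⟩ : ∃ T : ℝ, 0 ≤ T ∧ ∀ u ∈ P.failed, P.time u ≤ T := by
    refine ⟨∑ u ∈ P.failed, P.time u, Finset.sum_nonneg fun u _ => P.time_nonneg u, fun u hu => ?_⟩
    exact Finset.single_le_sum (fun u _ => P.time_nonneg u) hu
  have halive : ∀ u t, T ≤ t → P.Alive u t → u ∉ P.failed := fun u t ht hu hf =>
    absurd (hu hf) (not_lt.mpr ((hT u hf).trans ht))
  choose tok htok using fun t => (tokenMap_bijective hC.involutive (eventCount τ t)).surjective
  set O : ℝ → Finset V := fun t => (P.failedᶜ).image fun u => tok t (loc u t) with hO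
  have hcard : ∀ t, 0 ≤ t → (O t).card = (P.failedᶜ).card := by
    intro t ht
    refine Finset.card_image_of_injOn fun u hu v hv huv => ?_
    have hu' : u ∉ P.failed := by simpa using hu
    have hv' : v ∉ P.failed := by simpa using hv
    refine hC.loc_injective hP ht (Failures.alive_of_notMem hu' t)
      (Failures.alive_of_notMem hv' t) ?_
    rw [← htok t (loc u t), ← htok t (loc v t)]
    exact congrArg _ huv
  have hmem : ∀ t x, x ∈ O t ↔ ∃ u ∉ P.failed, loc u t = tokenMap M (eventCount τ t) x := by
    intro t x
    simp only [hO, Finset.mem_image, Finset.mem_compl]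
    refine exists_congr fun u => and_congr_right fun _ => ⟨?_, fun h => ?_⟩
    · rintro rfl
      exact (htok t _).symm
    · rw [h]
      exact (tokenMap_bijective hC.involutive _).injective (htok t _)
  refine ⟨T, O T, ?_, fun t ht0 ht x hx => ?_⟩
  · rw [hcard T hT0, Finset.card_compl]; omega
  · -- The set of occupied tokens can only shrink, but its size does not change after time `T`.
    have hsub : O t ⊆ O T := by
      intro y hy
      obtain ⟨u, hu, hu'⟩ := (hmem t y).mp hy
      obtain ⟨v, hv, hv'⟩ := hC.exists_alive_on_token hP hT0 ht (Failures.alive_of_notMem hu t) hu'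
      exact (hmem T y).mpr ⟨v, halive v T le_rfl hv, hv'⟩
    have heq := Finset.eq_of_subset_of_card_le hsub (by rw [hcard t ht0, hcard T hT0])
    exact (hmem t x).mp (heq ▸ hx)

/-- Fewer failures than the length of a ring leave a robot on every ring. -/
theorem toleratesFailures [Fintype V] (hC : LinkClock S F τ M) {L : ℕ} (hL : 0 < L)
    (hQ : ∀ k x, (tokenMap M 4)^[k] x = x ↔ L ∣ k) : ToleratesFailures S F (L - 1) := by
  classical
  intro P loc hcard hP i θ
  obtain ⟨T, O, hO, hsurv⟩ := hC.exists_surviving_tokens hP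
  obtain ⟨t₁, ht₁, hθ⟩ := F.exists_position_eq i θ
  obtain ⟨y, hy⟩ := (tokenMap_bijective hC.involutive (eventCount τ t₁)).surjective i
  obtain ⟨x, hxR, hxO⟩ : ∃ x, (∃ a, (tokenMap M 4)^[a] y = x) ∧ x ∈ O := by
    by_contra! hne
    have hdisj : Disjoint (Finset.univ.filter fun x => ∃ a, (tokenMap M 4)^[a] y = x) O :=
      Finset.disjoint_left.mpr fun x hx => hne x (Finset.mem_filter.mp hx).2
    have h1 := Finset.card_le_univ (Finset.disjUnion _ _ hdisj)
    rw [Finset.card_disjUnion, card_filter_iterate hL hQ] at h1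
    omega
  obtain ⟨a, rfl⟩ := hxR
  obtain ⟨N, hN⟩ := exists_nat_ge T
  -- The token moves by `Q` in every unit of time, so it is back at `(i, θ)` when the number of
  -- elapsed time units is congruent to `-a` modulo `L`.
  obtain ⟨c, hc⟩ : ∃ c, c + a = L * (a + N) := ⟨L * (a + N) - a, by
    have := Nat.le_mul_of_pos_left (a + N) hL
    omega⟩
  have hcN : N ≤ c := by
    have := Nat.le_mul_of_pos_left (a + N) hL
    omega
  refine ⟨t₁ + c, L, by positivity, by exact_mod_cast hL, fun k => ?_⟩
  have ht : t₁ + c + (k : ℝ) * L = t₁ + ((c + k * L : ℕ) : ℝ) := by push_cast; ring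
  have hcN' : (N : ℝ) ≤ c := by exact_mod_cast hcN
  have hkL : (0 : ℝ) ≤ (k : ℝ) * L := by positivity
  rw [ht]
  obtain ⟨u, hu, hu'⟩ := hsurv (t₁ + ((c + k * L : ℕ) : ℝ)) (by positivity)
    (by rw [← ht]; linarith) _ hxO
  refine ⟨u, hu, ?_, by rw [F.position_add_nat, hθ]⟩
  rw [hu', eventCount_add_nat hC.lt_quarter ht₁, tokenMap_add_four_mul hC.periodic,
    ← Function.iterate_add_apply, (hQ _ y).mpr, hy]
  exact ⟨a + N + k, by rw [mul_add, ← hc]; ring⟩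

end LinkClock

/-! ### The partial SCS of failures at time zero -/

open Classical in
/-- The trajectory of robot `u` after `k` events, if the robots in `D` are missing from the start:
at every event it passes to the facing trajectory if that is empty. -/
noncomputable def discreteLoc {V : Type*} (M : ℕ → V → V) (D : Finset V) : ℕ → V → V
  | 0, u => u
  | k + 1, u =>
    if ∀ v ∉ D, discreteLoc M D k v ≠ M k (discreteLoc M D k u) then M k (discreteLoc M D k u)
    else discreteLoc M D k u

/-- All robots in `D` leave at time `0`. -/
def initialFailures {V : Type*} (D : Finset V) : Failures V where
  failed := D
  time _ := 0
  time_nonneg _ := le_rfl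

theorem alive_initialFailures_iff {V : Type*} {D : Finset V} {u : V} {t : ℝ} (ht : 0 ≤ t) :
    (initialFailures D).Alive u t ↔ u ∉ D :=
  ⟨fun h hu => absurd (h hu) (not_lt.mpr ht), fun h hu => absurd hu h⟩

namespace LinkClock

variable {V : Type*} {S : RobotSystem V} {F : Schedule V} {τ : ℝ} {M : ℕ → V → V}

theorem isPartialSCS_discreteLoc (hC : LinkClock S F τ M) (D : Finset V) :
    IsPartialSCS S F (initialFailures D) fun u t => discreteLoc M D (eventCount τ t) u := by
  have hvac : ∀ {k : ℕ} {t : ℝ}, 0 ≤ t → eventCount τ t = k → ∀ j,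
      (Vacant (initialFailures D) (fun u t => discreteLoc M D (eventCount τ t) u) j t ↔
        ∀ v ∉ D, discreteLoc M D k v ≠ j) := by
    rintro k t ht rfl j
    simp only [Vacant, alive_initialFailures_iff ht]
  refine ⟨fun u => ?_, fun u t _ _ => ?_, fun u t ht hu j hj => ?_, fun u t ht hu hj => ?_⟩
  · simp only [eventCount_zero_of_nonneg hC.nonneg, discreteLoc]
  · filter_upwards [eventually_eventCount_nhdsLT τ t] with s hs
    rw [hs]
  · obtain ⟨⟨k, rfl, hk, -⟩, hv⟩ := (hC.mustPass_iff ht).mp hj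
    rw [hvac ht (eventCount_event τ k)] at hv
    simp only [eventCount_event] at hk
    filter_upwards [eventually_eventCount_nhdsGT_event τ k] with s hs
    rw [hs, discreteLoc, if_pos (by rw [hk]; exact hv), hk]
  · by_cases ht' : ∃ k : ℕ, t = τ + k / 4
    · obtain ⟨k, rfl⟩ := ht'
      filter_upwards [eventually_eventCount_nhdsGT_event τ k] with s hs
      rw [hs, eventCount_event, discreteLoc]
      split_ifs with h
      · by_contra hne
        refine hj (M k (discreteLoc M D k u)) ((hC.mustPass_iff ht).mpr ⟨⟨k, rfl, ?_, ?_⟩, ?_⟩)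
        · simp only [eventCount_event]
        · simp only [eventCount_event]; exact Ne.symm hne
        · exact (hvac ht (eventCount_event τ k) _).mpr h
      · rfl
    · push Not at ht'
      filter_upwards [eventually_eventCount_nhdsGT ht'] with s hs
      rw [hs]

/-- If all robots of the ring through `x` fail at time `0`, then no robot ever visits the starting
point of the trajectory `x` again. -/
theorem not_toleratesFailures [Fintype V] (hC : LinkClock S F τ M) {L k : ℕ} (hL : 0 < L)
    (hQ : ∀ k x, (tokenMap M 4)^[k] x = x ↔ L ∣ k) (x : V) (hk : L ≤ k) :
    ¬ ToleratesFailures S F k := by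
  classical
  intro h
  set D : Finset V := Finset.univ.filter fun y => ∃ a, (tokenMap M 4)^[a] x = y with hD
  have hP := hC.isPartialSCS_discreteLoc D
  obtain ⟨t₀, p, ht₀, hp, hvis⟩ := h (initialFailures D) _
    (((card_filter_iterate hL hQ x).trans_le hk)) hP x (F.position x 0)
  obtain ⟨u, hu, hloc, hpos⟩ := hvis 0
  rw [Nat.cast_zero, zero_mul, add_zero] at hloc hpos
  obtain ⟨z, rfl⟩ := (F.position_eq_iff x t₀ 0).mp hpos
  obtain ⟨c, rfl⟩ := Int.eq_ofNat_of_zero_le (a := z) (by rw [zero_add] at ht₀; exact_mod_cast ht₀)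
  rw [Int.cast_natCast] at ht₀ hloc
  have hcount : eventCount τ (0 + (c : ℝ)) = 0 + 4 * c := by
    rw [eventCount_add_nat hC.lt_quarter le_rfl, eventCount_zero_of_nonneg hC.nonneg]
  obtain ⟨y, hy⟩ := (tokenMap_bijective hC.involutive (eventCount τ (0 + (c : ℝ)))).surjective x
  obtain ⟨v, hv, hv'⟩ := hC.exists_alive_on_token hP le_rfl ht₀
    (Failures.alive_of_notMem hu _) (hloc.trans hy.symm)
  rw [eventCount_zero_of_nonneg hC.nonneg] at hv'
  obtain rfl : v = y := hv'
  rw [hcount, tokenMap_add_four_mul hC.periodic] at hy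
  refine (alive_initialFailures_iff le_rfl).mp hv (Finset.mem_filter.mpr ⟨Finset.mem_univ _, ?_⟩)
  refine ⟨L * c - c, ?_⟩
  have hy' : (tokenMap M 4)^[c] v = x := hy
  rw [← hy', ← Function.iterate_add_apply, Nat.sub_add_cancel (Nat.le_mul_of_pos_left c hL)]
  exact (hQ _ v).mpr (dvd_mul_right _ _)

/-- If all rings have length `L`, the uncovering-resilience is `L - 1`. -/
theorem isUncoveringResilience [Fintype V] [Nonempty V] (hC : LinkClock S F τ M) {L : ℕ}
    (hL : 0 < L) (hQ : ∀ k x, (tokenMap M 4)^[k] x = x ↔ L ∣ k) :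
    IsUncoveringResilience S F (L - 1) := by
  refine ⟨hC.toleratesFailures hL hQ, fun k hk => ?_⟩
  by_contra hlt
  exact hC.not_toleratesFailures hL hQ (Classical.arbitrary V) (by omega) hk

end LinkClock

/-! ### The cycle of a path -/

/-- One event on a path of `m` trajectories: those at `x` and `x + 1` are facing each other iff
`x + e` is even; the two are swapped. An end point without a partner is fixed. -/
def pathSwap {m : ℕ} (e : ℤ) (x : Fin m) : Fin m :=
  if (x + e) % 2 = 0 then if h : (x : ℕ) + 1 < m then ⟨x + 1, h⟩ else x
  else ⟨x - 1, by omega⟩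

theorem pathSwap_val {m : ℕ} (e : ℤ) (x : Fin m) : ((pathSwap e x : Fin m) : ℕ) =
    if (x + e) % 2 = 0 then if (x : ℕ) + 1 < m then (x : ℕ) + 1 else x else x - 1 := by
  unfold pathSwap; split_ifs <;> rfl

theorem pathSwap_eq_iff {m : ℕ} (e : ℤ) (x y : Fin m) : pathSwap e x = y ∧ x ≠ y ↔
    ((x : ℕ) + 1 = y ∧ (x + e) % 2 = 0) ∨ ((y : ℕ) + 1 = x ∧ (x + e) % 2 = 1) := by
  have hx := x.isLt
  have hy := y.isLt
  have h := pathSwap_val e x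
  rw [ne_eq, Fin.ext_iff, Fin.ext_iff]
  split_ifs at h <;> omega

theorem pathSwap_involutive {m : ℕ} (e : ℤ) :
    Function.Involutive (pathSwap e : Fin m → Fin m) := by
  intro x
  have hx := x.isLt
  apply Fin.ext
  have h := pathSwap_val e x
  rw [pathSwap_val]
  split_ifs at h ⊢ <;> omega

theorem pathSwap_add_two {m : ℕ} (e : ℤ) (x : Fin m) : pathSwap (e + 2) x = pathSwap e x := by
  apply Fin.ext
  rw [pathSwap_val, pathSwap_val]
  split_ifs <;> omega

/-- The position of `x` on the closed tour `0, …, m - 1, m - 1, …, 0` of length `2 * m`. Of the two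
occurrences of `x`, the one from which the next event leads forward is taken. -/
def tourIndex {m : ℕ} (e : ℤ) (x : Fin m) : ℤ :=
  if (x + e) % 2 = 0 then x else 2 * m - 1 - x

/-- An alternating pair of swaps advances every vertex by `2` on the closed tour. -/
theorem tourIndex_step {m : ℕ} (e : ℤ) (x : Fin m) : (2 * m : ℤ) ∣
    tourIndex e (pathSwap (e + 1) (pathSwap e x)) - (tourIndex e x + 2) := by
  have hx := x.isLt
  have h1 := pathSwap_val e x
  have h2 := pathSwap_val (e + 1) (pathSwap e x)
  suffices h : tourIndex e (pathSwap (e + 1) (pathSwap e x)) - (tourIndex e x + 2) = 0 ∨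
      tourIndex e (pathSwap (e + 1) (pathSwap e x)) - (tourIndex e x + 2) = -(2 * m : ℤ) by
    rcases h with h | h
    · exact h ▸ dvd_zero _
    · exact h ▸ (dvd_refl _).neg_right
  unfold tourIndex
  split_ifs at h1 h2 ⊢ <;> omega

theorem tourIndex_injective {m : ℕ} (e : ℤ) {x y : Fin m}
    (h : (2 * m : ℤ) ∣ tourIndex e x - tourIndex e y) : x = y := by
  have hx := x.isLt
  have hy := y.isLt
  have h0 : tourIndex e x - tourIndex e y = 0 := by
    refine Int.eq_zero_of_abs_lt_dvd h ?_
    rw [abs_lt]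
    unfold tourIndex
    split_ifs <;> constructor <;> omega
  apply Fin.ext
  unfold tourIndex at h0
  split_ifs at h0 <;> omega

/-- The two alternating swaps of a path of `m` vertices compose to an `m`-cycle. -/
theorem pathSwap_comp_iterate_eq_iff {m : ℕ} (e : ℤ) (k : ℕ) (x : Fin m) :
    (pathSwap (e + 1) ∘ pathSwap e)^[k] x = x ↔ m ∣ k := by
  have hk : (2 * m : ℤ) ∣
      tourIndex e ((pathSwap (e + 1) ∘ pathSwap e)^[k] x) - (tourIndex e x + 2 * k) := by
    induction k with
    | zero => exact ⟨0, by simp⟩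
    | succ k ih =>
      rw [Function.iterate_succ_apply']
      obtain ⟨a, ha⟩ := tourIndex_step e ((pathSwap (e + 1) ∘ pathSwap e)^[k] x)
      obtain ⟨b, hb⟩ := ih
      refine ⟨a + b, ?_⟩
      rw [Function.comp_apply]
      push_cast
      linear_combination ha + hb
  have h2 : (2 * m : ℤ) ∣ 2 * k ↔ m ∣ k := by
    rw [mul_dvd_mul_iff_left two_ne_zero, Int.natCast_dvd_natCast]
  rw [← h2]
  constructor
  · intro h
    rw [h] at hk
    simpa using hk
  · intro h
    refine tourIndex_injective e ?_
    have := dvd_add hk h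
    rwa [← sub_sub, sub_add_cancel] at this

/-! ### The token permutation of a grid -/

/-- The `q`-th event of a grid. Events alternate between rows and columns; `g` is the direction of
movement in the upper left corner. -/
def gridStep {n m : ℕ} (g q : ℤ) (v : Fin n × Fin m) : Fin n × Fin m :=
  if q % 2 = 0 then (v.1, pathSwap (q / 2) v.2) else (pathSwap ((q + g) / 2) v.1, v.2)

theorem gridStep_involutive {n m : ℕ} (g q : ℤ) :
    Function.Involutive (gridStep g q : Fin n × Fin m → Fin n × Fin m) := by
  intro v
  by_cases h : q % 2 = 0
  · simp [gridStep, h, pathSwap_involutive (q / 2) v.2]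
  · simp [gridStep, h, pathSwap_involutive ((q + g) / 2) v.1]

theorem gridStep_add_four {n m : ℕ} (g q : ℤ) :
    (gridStep g (q + 4) : Fin n × Fin m → Fin n × Fin m) = gridStep g q := by
  funext v
  have h1 : (q + 4) % 2 = q % 2 := by omega
  have h2 : (q + 4) / 2 = q / 2 + 2 := by omega
  have h3 : (q + 4 + g) / 2 = (q + g) / 2 + 2 := by omega
  simp only [gridStep, h1, h2, h3, pathSwap_add_two]

/-- The swaps of rows and those of columns commute, so the four events of a unit of time make up an
alternating pair of swaps of each kind. -/
theorem exists_tokenMap_gridStep {n m : ℕ} (g c : ℤ) : ∃ e e' : ℤ,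
    tokenMap (fun k : ℕ => (gridStep g (c + k) : Fin n × Fin m → Fin n × Fin m)) 4 =
      Prod.map (pathSwap (e + 1) ∘ pathSwap e) (pathSwap (e' + 1) ∘ pathSwap e') := by
  rcases Int.emod_two_eq_zero_or_one c with h | h
  · refine ⟨(c + 1 + g) / 2, c / 2, ?_⟩
    funext ⟨i, j⟩
    have h1 : (c + 1) % 2 ≠ 0 := by omega
    have h2 : (c + 2) % 2 = 0 := by omega
    have h3 : (c + 3) % 2 ≠ 0 := by omega
    have h4 : (c + 2) / 2 = c / 2 + 1 := by omega
    have h5 : (c + 3 + g) / 2 = (c + 1 + g) / 2 + 1 := by omega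
    simp [tokenMap, gridStep, h, h1, h2, h3, h4, h5]
  · refine ⟨(c + g) / 2, (c + 1) / 2, ?_⟩
    funext ⟨i, j⟩
    have h1 : (c + 1) % 2 = 0 := by omega
    have h3 : (c + 3) % 2 = 0 := by omega
    have h4 : (c + 2 + g) / 2 = (c + g) / 2 + 1 := by omega
    have h5 : (c + 3) / 2 = (c + 1) / 2 + 1 := by omega
    simp [tokenMap, gridStep, h, h1, h3, h4, h5]

/-- All rings of an `n × m` grid have length `lcm n m`: in one unit of time, the tokens move by an
`n`-cycle of the rows and an `m`-cycle of the columns. -/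
theorem tokenMap_gridStep_iterate_eq_iff {n m : ℕ} (g c : ℤ) (k : ℕ) (x : Fin n × Fin m) :
    (tokenMap (fun k : ℕ => gridStep g (c + k)) 4)^[k] x = x ↔ n * m / Nat.gcd n m ∣ k := by
  obtain ⟨e, e', h⟩ := exists_tokenMap_gridStep (n := n) (m := m) g c
  rw [h, Prod.map_iterate, Prod.map_apply', Prod.ext_iff, pathSwap_comp_iterate_eq_iff,
    pathSwap_comp_iterate_eq_iff, ← Nat.lcm_dvd_iff, Nat.lcm]

/-! ### Schedules in quarter turns -/

/-- The angle of `x` quarter turns. -/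
noncomputable def quarterTurns (x : ℝ) : Real.Angle := ((x * (Real.pi / 2) : ℝ) : Real.Angle)

theorem quarterTurns_eq_iff {x y : ℝ} : quarterTurns x = quarterTurns y ↔
    ∃ z : ℤ, x - y = 4 * z := by
  rw [quarterTurns, quarterTurns, Real.Angle.angle_eq_iff_two_pi_dvd_sub]
  refine exists_congr fun z => ?_
  have hpi := Real.pi_pos
  constructor <;> intro h
  · have : Real.pi / 2 * (x - y) = Real.pi / 2 * (4 * z) := by linarith
    exact mul_left_cancel₀ (by positivity) this
  · linear_combination (Real.pi / 2) * h

theorem quarterTurns_add (x y : ℝ) :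
    quarterTurns (x + y) = quarterTurns x + quarterTurns y := by
  rw [quarterTurns, quarterTurns, quarterTurns, ← Real.Angle.coe_add, add_mul]

theorem quarterTurns_neg (x : ℝ) : quarterTurns (-x) = -quarterTurns x := by
  rw [quarterTurns, quarterTurns, ← Real.Angle.coe_neg, neg_mul]

theorem Schedule.position_eq_quarterTurns {V : Type*} (F : Schedule V) (i : V) (t : ℝ) :
    F.position i t = F.start i + quarterTurns ((F.dir i : ℤ) * (4 * t)) := by
  rw [Schedule.position, quarterTurns]
  congr 2
  ring

theorem Schedule.position_add_position {V : Type*} (F : Schedule V) {v w : V}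
    (h : F.dir v = -F.dir w) (t : ℝ) :
    F.position v t + F.position w t = F.start v + F.start w := by
  have h0 : quarterTurns 0 = 0 := by simp [quarterTurns]
  rw [F.position_eq_quarterTurns, F.position_eq_quarterTurns, add_add_add_comm,
    ← quarterTurns_add, h]
  push_cast
  rw [neg_mul, neg_add_cancel, h0, add_zero]

/-- For robots moving in opposite directions, being synchronized at all times is a condition on the
starting angles. -/
theorem isSCS_iff {V : Type*} (S : RobotSystem V) (F : Schedule V) :
    IsSCS S F ↔ ∀ v w, S.commGraph.Adj v w → F.dir v = -F.dir w ∧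
      F.start v + F.start w = S.linkPosition v w + S.linkPosition w v := by
  constructor
  · intro h v w hvw
    refine ⟨h.opposite v w hvw, ?_⟩
    obtain ⟨t, ht, hv⟩ := F.exists_position_eq v (S.linkPosition v w)
    have hw := (h.synchronized v w hvw t ht).mp hv
    rw [← F.position_add_position (h.opposite v w hvw) t, hv, hw]
  · intro h
    refine ⟨fun v w hvw => (h v w hvw).1, fun v w hvw t _ => ?_⟩
    have hs := (F.position_add_position (h v w hvw).1 t).trans (h v w hvw).2
    constructor <;> intro he <;> rw [he] at hs
    · exact add_left_cancel hs
    · exact add_right_cancel hs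

/-! ### Synchronized schedules on a grid -/

namespace IsGrid

variable {n m : ℕ} {S : RobotSystem (Fin n × Fin m)}

theorem adj_iff (hS : IsGrid S) (v w : Fin n × Fin m) : S.commGraph.Adj v w ↔
    (v.1 = w.1 ∧ ((v.2 : ℕ) + 1 = w.2 ∨ (w.2 : ℕ) + 1 = v.2)) ∨
      (v.2 = w.2 ∧ ((v.1 : ℕ) + 1 = w.1 ∨ (w.1 : ℕ) + 1 = v.1)) := by
  rw [hS.graph_eq, SimpleGraph.boxProd_adj, SimpleGraph.pathGraph_adj, SimpleGraph.pathGraph_adj]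
  tauto

theorem linkPosition_right (hS : IsGrid S) {v w : Fin n × Fin m} (h1 : v.1 = w.1)
    (h2 : v.2 < w.2) : S.linkPosition v w = quarterTurns 0 := by
  obtain ⟨x, y, hx, -, hc⟩ := hS.aligned
  obtain ⟨i, j⟩ := v
  obtain ⟨i', j'⟩ := w
  obtain rfl : i = i' := h1
  have harg : (S.center (i, j') - S.center (i, j)).arg = 0 := by
    rw [Complex.arg_eq_zero_iff, hc, hc]
    simpa using (hx h2).le
  rw [RobotSystem.linkPosition, harg, quarterTurns, zero_mul]

theorem linkPosition_left (hS : IsGrid S) {v w : Fin n × Fin m} (h1 : v.1 = w.1)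
    (h2 : w.2 < v.2) : S.linkPosition v w = quarterTurns 2 := by
  obtain ⟨x, y, hx, -, hc⟩ := hS.aligned
  obtain ⟨i, j⟩ := v
  obtain ⟨i', j'⟩ := w
  obtain rfl : i = i' := h1
  have harg : (S.center (i, j') - S.center (i, j)).arg = Real.pi := by
    rw [Complex.arg_eq_pi_iff, hc, hc]
    simpa using hx h2
  rw [RobotSystem.linkPosition, harg, quarterTurns]
  congr 1; ring

theorem linkPosition_up (hS : IsGrid S) {v w : Fin n × Fin m} (h1 : v.2 = w.2)
    (h2 : w.1 < v.1) : S.linkPosition v w = quarterTurns 1 := by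
  obtain ⟨x, y, -, hy, hc⟩ := hS.aligned
  obtain ⟨i, j⟩ := v
  obtain ⟨i', j'⟩ := w
  obtain rfl : j = j' := h1
  have harg : (S.center (i', j) - S.center (i, j)).arg = Real.pi / 2 := by
    rw [Complex.arg_eq_pi_div_two_iff, hc, hc]
    simpa using hy h2
  rw [RobotSystem.linkPosition, harg, quarterTurns, one_mul]

theorem linkPosition_down (hS : IsGrid S) {v w : Fin n × Fin m} (h1 : v.2 = w.2)
    (h2 : v.1 < w.1) : S.linkPosition v w = quarterTurns (-1) := by
  obtain ⟨x, y, -, hy, hc⟩ := hS.aligned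
  obtain ⟨i, j⟩ := v
  obtain ⟨i', j'⟩ := w
  obtain rfl : j = j' := h1
  have harg : (S.center (i', j) - S.center (i, j)).arg = -(Real.pi / 2) := by
    rw [Complex.arg_eq_neg_pi_div_two_iff, hc, hc]
    simpa using hy h2
  rw [RobotSystem.linkPosition, harg, quarterTurns]
  congr 1; ring

theorem link_sum_row (hS : IsGrid S) {v w : Fin n × Fin m} (h1 : v.1 = w.1)
    (h2 : (v.2 : ℕ) + 1 = w.2) :
    S.linkPosition v w + S.linkPosition w v = quarterTurns 2 := by
  have h : v.2 < w.2 := Fin.lt_def.mpr (by omega)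
  rw [hS.linkPosition_right h1 h, hS.linkPosition_left h1.symm h, ← quarterTurns_add, zero_add]

theorem link_sum_column (hS : IsGrid S) {v w : Fin n × Fin m} (h1 : v.2 = w.2)
    (h2 : (v.1 : ℕ) + 1 = w.1) :
    S.linkPosition v w + S.linkPosition w v = quarterTurns 0 := by
  have h : v.1 < w.1 := Fin.lt_def.mpr (by omega)
  rw [hS.linkPosition_down h1 h, hS.linkPosition_up h1.symm h, ← quarterTurns_add, neg_add_cancel]

theorem isSCS_iff (hS : IsGrid S) (F : Schedule (Fin n × Fin m)) : IsSCS S F ↔ ∀ v w,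
    (v.1 = w.1 → (v.2 : ℕ) + 1 = w.2 →
      F.dir v = -F.dir w ∧ F.start v + F.start w = quarterTurns 2) ∧
    (v.2 = w.2 → (v.1 : ℕ) + 1 = w.1 →
      F.dir v = -F.dir w ∧ F.start v + F.start w = quarterTurns 0) := by
  rw [_root_.isSCS_iff]
  constructor
  · intro h v w
    refine ⟨fun h1 h2 => ?_, fun h1 h2 => ?_⟩
    · rw [← hS.link_sum_row h1 h2]
      exact h v w ((hS.adj_iff v w).mpr (.inl ⟨h1, .inl h2⟩))
    · rw [← hS.link_sum_column h1 h2]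
      exact h v w ((hS.adj_iff v w).mpr (.inr ⟨h1, .inl h2⟩))
  · intro h v w hvw
    have hflip : F.dir w = -F.dir v ∧
        F.start w + F.start v = S.linkPosition w v + S.linkPosition v w →
        F.dir v = -F.dir w ∧
        F.start v + F.start w = S.linkPosition v w + S.linkPosition w v := fun ⟨a, b⟩ =>
      ⟨by rw [a, neg_neg], by rw [add_comm, b, add_comm]⟩
    rcases (hS.adj_iff v w).mp hvw with ⟨h1, h2 | h2⟩ | ⟨h1, h2 | h2⟩
    · exact hS.link_sum_row h1 h2 ▸ (h v w).1 h1 h2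
    · exact hflip (hS.link_sum_row h1.symm h2 ▸ (h w v).1 h1.symm h2)
    · exact hS.link_sum_column h1 h2 ▸ (h v w).2 h1 h2
    · exact hflip (hS.link_sum_column h1.symm h2 ▸ (h w v).2 h1.symm h2)

/-- A synchronized schedule: the starting angles are `0` in even columns and `π` in odd columns, and
the directions alternate. -/
theorem exists_isSCS (hS : IsGrid S) : ∃ F : Schedule (Fin n × Fin m), IsSCS S F := by
  refine ⟨⟨fun v => quarterTurns (2 * (v.2 : ℕ)), fun v => (-1) ^ ((v.1 : ℕ) + v.2)⟩,
    (hS.isSCS_iff _).mpr fun v w => ⟨fun h1 h2 => ⟨?_, ?_⟩, fun h1 h2 => ⟨?_, ?_⟩⟩⟩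
  · simp only [← h1, ← h2, ← add_assoc, pow_succ]; simp
  · rw [← quarterTurns_add, quarterTurns_eq_iff]
    exact ⟨(v.2 : ℕ), by rw [← h2]; push_cast; ring⟩
  · simp only [← h1, ← h2, pow_add, pow_one]; simp
  · rw [← quarterTurns_add, quarterTurns_eq_iff]
    exact ⟨(v.2 : ℕ), by rw [← h1]; push_cast; ring⟩

/-- A synchronized schedule is determined by its values in the upper left corner. -/
theorem position_eq (hS : IsGrid S) {F : Schedule (Fin n × Fin m)} (hF : IsSCS S F) {g : ℤ} {x : ℝ}
    (hn : 0 < n) (hm : 0 < m) (hg : F.dir (⟨0, hn⟩, ⟨0, hm⟩) = g)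
    (hx : F.start (⟨0, hn⟩, ⟨0, hm⟩) = quarterTurns (g * x)) (v : Fin n × Fin m) (t : ℝ) :
    F.position v t =
      quarterTurns ((((-1) ^ ((v.1 : ℕ) + v.2) * g : ℤ) : ℝ) * (x + 4 * t) + 2 * (v.2 : ℕ)) := by
  rw [hS.isSCS_iff] at hF
  have key : ∀ i j (hi : i < n) (hj : j < m),
      (F.dir (⟨i, hi⟩, ⟨j, hj⟩) : ℤ) = (-1) ^ (i + j) * g ∧
      F.start (⟨i, hi⟩, ⟨j, hj⟩) =
        quarterTurns ((((-1) ^ (i + j) * g : ℤ) : ℝ) * x + 2 * j) := by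
    intro i
    induction i with
    | zero =>
      intro j hi hj
      induction j with
      | zero => simpa using ⟨hg, hx⟩
      | succ j ih =>
        obtain ⟨ih1, ih2⟩ := ih (by omega)
        obtain ⟨h1, h2⟩ := (hF (⟨0, hi⟩, ⟨j, by omega⟩) (⟨0, hi⟩, ⟨j + 1, hj⟩)).1 rfl rfl
        constructor
        · rw [h1] at ih1
          push_cast at ih1
          rw [← add_assoc, pow_succ]; linarith
        · rw [eq_sub_of_add_eq' h2, ih2, sub_eq_add_neg, ← quarterTurns_neg, ← quarterTurns_add,
            quarterTurns_eq_iff]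
          exact ⟨-j, by push_cast; ring⟩
    | succ i ih =>
      intro j hi hj
      obtain ⟨ih1, ih2⟩ := ih j (by omega) hj
      obtain ⟨h1, h2⟩ := (hF (⟨i, by omega⟩, ⟨j, hj⟩) (⟨i + 1, hi⟩, ⟨j, hj⟩)).2 rfl rfl
      constructor
      · rw [h1] at ih1
        push_cast at ih1
        rw [show i + 1 + j = i + j + 1 by ring, pow_succ]; linarith
      · rw [eq_sub_of_add_eq' h2, ih2, sub_eq_add_neg, ← quarterTurns_neg, ← quarterTurns_add,
          quarterTurns_eq_iff]
        exact ⟨-j, by push_cast; ring⟩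
  obtain ⟨h1, h2⟩ := key v.1 v.2 v.1.isLt v.2.isLt
  rw [F.position_eq_quarterTurns]
  simp only [Fin.eta, Prod.mk.eta] at h1 h2
  rw [h1, h2, ← quarterTurns_add]
  congr 1; ring

/-- `θ` is the link position of `v` towards a neighbor `w` iff `w` is the next trajectory to the right,
left, below or above and `θ` is the corresponding multiple of a quarter turn. -/
theorem facing_iff (hS : IsGrid S) (v w : Fin n × Fin m) (θ : Real.Angle) :
    S.commGraph.Adj v w ∧ θ = S.linkPosition v w ↔
      (v.1 = w.1 ∧ (v.2 : ℕ) + 1 = w.2 ∧ θ = quarterTurns (0 : ℤ)) ∨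
      (v.1 = w.1 ∧ (w.2 : ℕ) + 1 = v.2 ∧ θ = quarterTurns (2 : ℤ)) ∨
      (v.2 = w.2 ∧ (v.1 : ℕ) + 1 = w.1 ∧ θ = quarterTurns (-1 : ℤ)) ∨
      (v.2 = w.2 ∧ (w.1 : ℕ) + 1 = v.1 ∧ θ = quarterTurns (1 : ℤ)) := by
  push_cast
  rw [hS.adj_iff]
  constructor
  · rintro ⟨⟨h1, h2 | h2⟩ | ⟨h1, h2 | h2⟩, rfl⟩
    · exact .inl ⟨h1, h2, hS.linkPosition_right h1 (Fin.lt_def.mpr (by omega))⟩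
    · exact .inr (.inl ⟨h1, h2, hS.linkPosition_left h1 (Fin.lt_def.mpr (by omega))⟩)
    · exact .inr (.inr (.inl ⟨h1, h2, hS.linkPosition_down h1 (Fin.lt_def.mpr (by omega))⟩))
    · exact .inr (.inr (.inr ⟨h1, h2, hS.linkPosition_up h1 (Fin.lt_def.mpr (by omega))⟩))
  · rintro (⟨h1, h2, rfl⟩ | ⟨h1, h2, rfl⟩ | ⟨h1, h2, rfl⟩ | ⟨h1, h2, rfl⟩)
    · exact ⟨.inl ⟨h1, .inl h2⟩, (hS.linkPosition_right h1 (Fin.lt_def.mpr (by omega))).symm⟩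
    · exact ⟨.inl ⟨h1, .inr h2⟩, (hS.linkPosition_left h1 (Fin.lt_def.mpr (by omega))).symm⟩
    · exact ⟨.inr ⟨h1, .inl h2⟩, (hS.linkPosition_down h1 (Fin.lt_def.mpr (by omega))).symm⟩
    · exact ⟨.inr ⟨h1, .inr h2⟩, (hS.linkPosition_up h1 (Fin.lt_def.mpr (by omega))).symm⟩

end IsGrid

/-- At the `q`-th event, the position of `v` is `±q + 2 * v.2` quarter turns, with the sign of the
direction of `v`. So `gridStep` leads to the neighbor (to the right, left, below, above) whose link
position this is. -/
theorem gridStep_eq_iff {n m : ℕ} {g : ℤ} (hg : g = 1 ∨ g = -1) (q : ℤ) (v w : Fin n × Fin m) :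
    gridStep g q v = w ∧ v ≠ w ↔
      (v.1 = w.1 ∧ (v.2 : ℕ) + 1 = w.2 ∧
        (4 : ℤ) ∣ (-1) ^ ((v.1 : ℕ) + v.2) * g * q + 2 * (v.2 : ℕ) - 0) ∨
      (v.1 = w.1 ∧ (w.2 : ℕ) + 1 = v.2 ∧
        (4 : ℤ) ∣ (-1) ^ ((v.1 : ℕ) + v.2) * g * q + 2 * (v.2 : ℕ) - 2) ∨
      (v.2 = w.2 ∧ (v.1 : ℕ) + 1 = w.1 ∧
        (4 : ℤ) ∣ (-1) ^ ((v.1 : ℕ) + v.2) * g * q + 2 * (v.2 : ℕ) - (-1)) ∨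
      (v.2 = w.2 ∧ (w.1 : ℕ) + 1 = v.1 ∧
        (4 : ℤ) ∣ (-1) ^ ((v.1 : ℕ) + v.2) * g * q + 2 * (v.2 : ℕ) - 1) := by
  obtain ⟨i, j⟩ := v
  obtain ⟨i', j'⟩ := w
  obtain ⟨a, ha⟩ : ∃ a : ℤ, (-1) ^ ((i : ℕ) + j) * g * q + 2 * (j : ℕ) = a := ⟨_, rfl⟩
  have hmod : ((4 : ℤ) ∣ a - 0 ↔ q % 2 = 0 ∧ (j + q / 2) % 2 = 0) ∧
      ((4 : ℤ) ∣ a - 2 ↔ q % 2 = 0 ∧ (j + q / 2) % 2 = 1) ∧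
      ((4 : ℤ) ∣ a - (-1) ↔ q % 2 ≠ 0 ∧ (i + (q + g) / 2) % 2 = 0) ∧
      ((4 : ℤ) ∣ a - 1 ↔ q % 2 ≠ 0 ∧ (i + (q + g) / 2) % 2 = 1) := by
    rcases Nat.even_or_odd ((i : ℕ) + j) with h | h <;> rw [h.neg_one_pow] at ha
    · have hp := Nat.even_iff.mp h
      rcases hg with rfl | rfl <;> refine ⟨?_, ?_, ?_, ?_⟩ <;> omega
    · have hp := Nat.odd_iff.mp h
      rcases hg with rfl | rfl <;> refine ⟨?_, ?_, ?_, ?_⟩ <;> omega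
  dsimp only
  rw [ha, hmod.1, hmod.2.1, hmod.2.2.1, hmod.2.2.2]
  by_cases hq : q % 2 = 0
  · by_cases hi : i = i'
    · simpa [gridStep, hq, hi] using pathSwap_eq_iff (q / 2) j j'
    · simp [gridStep, hq, hi]
  · by_cases hj : j = j'
    · simpa [gridStep, hq, hj] using pathSwap_eq_iff ((q + g) / 2) i i'
    · simp [gridStep, hq, hj]

/-- The events of a synchronized schedule on a grid. -/
theorem IsGrid.exists_linkClock {n m : ℕ} {S : RobotSystem (Fin n × Fin m)} (hS : IsGrid S)
    (hn : 0 < n) (hm : 0 < m) {F : Schedule (Fin n × Fin m)} (hF : IsSCS S F) :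
    ∃ (τ : ℝ) (g c : ℤ), LinkClock S F τ fun k : ℕ => gridStep g (c + k) := by
  obtain ⟨g, hgd⟩ : ∃ g : ℤ, (F.dir (⟨0, hn⟩, ⟨0, hm⟩) : ℤ) = g := ⟨_, rfl⟩
  have hg : g = 1 ∨ g = -1 := by
    rcases Int.units_eq_one_or (F.dir (⟨0, hn⟩, ⟨0, hm⟩)) with h | h <;> rw [h] at hgd <;>
      simp at hgd <;> omega
  -- In the upper left corner, the position at time `t` is `g * (x + 4 * t)` quarter turns, and the
  -- events are the times where `x + 4 * t` is an integer.
  obtain ⟨x, hx⟩ : ∃ x : ℝ, F.start (⟨0, hn⟩, ⟨0, hm⟩) = quarterTurns (g * x) := by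
    have hgg : (g : ℝ) * g = 1 := by rcases hg with rfl | rfl <;> norm_num
    refine ⟨g * ((F.start (⟨0, hn⟩, ⟨0, hm⟩)).toReal / (Real.pi / 2)), ?_⟩
    rw [← mul_assoc, hgg, one_mul, quarterTurns, div_mul_cancel₀ _ (by positivity),
      Real.Angle.coe_toReal]
  have hpos := hS.position_eq hF hn hm hgd hx
  have h1 := Int.le_ceil x
  have h2 := Int.ceil_lt_add_one x
  refine ⟨(⌈x⌉ - x) / 4, g, ⌈x⌉, by linarith, by linarith, fun k => gridStep_involutive g _,
    fun k => ?_, fun v w t ht => ?_⟩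
  · push_cast
    rw [← add_assoc, gridStep_add_four]
  · have hint : ∀ d : ℤ, F.position v t = quarterTurns d ↔ ∃ k : ℕ, t = (⌈x⌉ - x) / 4 + k / 4 ∧
        (4 : ℤ) ∣ (-1) ^ ((v.1 : ℕ) + v.2) * g * (⌈x⌉ + k) + 2 * (v.2 : ℕ) - d := by
      intro d
      set σ : ℤ := (-1) ^ ((v.1 : ℕ) + v.2) * g with hσ
      have hσσ : σ * σ = 1 := by
        rcases hg with rfl | rfl <;> rcases neg_one_pow_eq_or ℤ ((v.1 : ℕ) + v.2) with h | h <;>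
          rw [hσ, h] <;> norm_num
      have hσσ' : (σ : ℝ) * σ = 1 := by exact_mod_cast hσσ
      rw [hpos v t, quarterTurns_eq_iff]
      constructor
      · rintro ⟨z, hz⟩
        have hy : x + 4 * t = ((σ * (4 * z + d - 2 * (v.2 : ℕ)) : ℤ) : ℝ) := by
          push_cast
          linear_combination (σ : ℝ) * hz - (x + 4 * t) * hσσ'
        have hge : ⌈x⌉ ≤ σ * (4 * z + d - 2 * (v.2 : ℕ)) := by
          rw [Int.ceil_le, ← hy]; linarith
        obtain ⟨k, hk⟩ := Int.le.dest hge
        refine ⟨k, ?_, z, ?_⟩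
        · rw [← hk] at hy; push_cast at hy; linarith
        · rw [hk]; linear_combination (4 * z + d - 2 * (v.2 : ℕ)) * hσσ
      · rintro ⟨k, rfl, z, hz⟩
        refine ⟨z, ?_⟩
        have hz' : (σ : ℝ) * (⌈x⌉ + k) + 2 * (v.2 : ℕ) - d = 4 * z := by exact_mod_cast hz
        rw [← hz']; ring
    rw [hS.facing_iff]
    simp only [hint, gridStep_eq_iff hg]
    constructor
    · rintro (⟨h1, h2, k, hk, h3⟩ | ⟨h1, h2, k, hk, h3⟩ | ⟨h1, h2, k, hk, h3⟩ | ⟨h1, h2, k, hk, h3⟩)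
      · exact ⟨k, hk, .inl ⟨h1, h2, h3⟩⟩
      · exact ⟨k, hk, .inr (.inl ⟨h1, h2, h3⟩)⟩
      · exact ⟨k, hk, .inr (.inr (.inl ⟨h1, h2, h3⟩))⟩
      · exact ⟨k, hk, .inr (.inr (.inr ⟨h1, h2, h3⟩))⟩
    · rintro ⟨k, hk, ⟨h1, h2, h3⟩ | ⟨h1, h2, h3⟩ | ⟨h1, h2, h3⟩ | ⟨h1, h2, h3⟩⟩
      · exact .inl ⟨h1, h2, k, hk, h3⟩
      · exact .inr (.inl ⟨h1, h2, k, hk, h3⟩)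
      · exact .inr (.inr (.inl ⟨h1, h2, k, hk, h3⟩))
      · exact .inr (.inr (.inr ⟨h1, h2, k, hk, h3⟩))

theorem mainTheorem3 (n m : ℕ) (hn : 0 < n) (hm : 0 < m) (S : RobotSystem (Fin n × Fin m))
    (hS : IsGrid S) :
    (∃ F : Schedule (Fin n × Fin m), IsSCS S F) ∧
      ∀ F : Schedule (Fin n × Fin m), IsSCS S F →
        IsUncoveringResilience S F (n * m / Nat.gcd n m - 1) := by
  refine ⟨hS.exists_isSCS, fun F hF => ?_⟩
  obtain ⟨τ, g, c, hC⟩ := hS.exists_linkClock hn hm hF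
  have : Nonempty (Fin n × Fin m) := ⟨(⟨0, hn⟩, ⟨0, hm⟩)⟩
  exact hC.isUncoveringResilience (Nat.lcm_pos hn hm) (tokenMap_gridStep_iterate_eq_iff g c)
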